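/- An inverse semigroup is a semigroup $S$ in which every element $a$ has a unique inverse $a^{-1}$, i.e. a unique $b$ with $aba=a$ and $bab=b$; finitely generated (f.g.) means generated, using product and inverse, by finitely many (at least one) elements. For an idempotent $e$ of $S$, the maximal subgroup at $e$ is $H_e=\{a\in S: aa^{-1}=e=a^{-1}a\}$. The age of a group $G$ is the class of all f.g. groups that embed in $G$. A class $\mathcal K$ of f.g. inverse semigroups is a Fraïssé class if it is non-empty, contains only countably many isomorphism types, is closed under isomorphism, and has the hereditary property (f.g. inverse subsemigroups of members are members), the joint embedding property (any two members embed in a common member) and the amalgamation property (for $A,B_1,B_2\in\mathcal K$ with $A\neq\emptyset$ and embeddings $f_i:A\to B_i$ there are $D\in\mathcal K$ and embeddings $g_i:B_i\to D$ with $g_1\circ f_1=g_2\circ f_2$). Let $G$ be a homogeneous abelian group, that is, a countable abelian group in which every isomorphism between f.g. subgroups extends to an automorphism of $G$. Assume that $G$ is component-wise non co-Hopfian: for every prime $p$ for which the $p$-component of $G$ is non-trivial, the $p$-component has an injective endomorphism that is not surjective; and the torsion-free rank of $G$ is $0$ or $\aleph_0$. Let $\mathcal K[G]$ be the class of all f.g.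 commutative inverse semigroups all of whose maximal subgroups belong to the age of $G$. Then $\mathcal K[G]$ is a Fraïssé class. -/

import Mathlib

universe u v

/-- An inverse semigroup: a semigroup in which every element `a` has a unique inverse `a⁻¹`,
that is, a unique element `b` with `a * b * a = a` and `b * a * b = b`. -/
class InverseSemigroup (S : Type u) extends Semigroup S, Inv S where
  mul_inv_mul (a : S) : a * a⁻¹ * a = a
  inv_mul_inv (a : S) : a⁻¹ * a * a⁻¹ = a⁻¹
  eq_inv_of_inverse (a b : S) : a * b * a = a → b * a * b = b → b = a⁻¹

/-- Every group is an inverse semigroup, with the same product and the same inverses. -/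
instance Group.toInverseSemigroup (G : Type u) [Group G] : InverseSemigroup G where
  mul_inv_mul a := by simp
  inv_mul_inv a := by simp
  eq_inv_of_inverse a b h _ := by
    rw [mul_assoc, mul_eq_left] at h
    exact eq_inv_of_mul_eq_one_left h

/-- An inverse subsemigroup: a subset closed under products and inverses. -/
structure InverseSubsemigroup (S : Type u) [InverseSemigroup S] extends Subsemigroup S where
  inv_mem' {a : S} : a ∈ carrier → a⁻¹ ∈ carrier

namespace InverseSubsemigroup

variable {S : Type u} [InverseSemigroup S]

instance : SetLike (InverseSubsemigroup S) S where
  coe T := T.carrier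
  coe_injective T U h := by
    obtain ⟨⟨T, _⟩, _⟩ := T
    obtain ⟨⟨U, _⟩, _⟩ := U
    cases h
    rfl

/-- An inverse subsemigroup is itself an inverse semigroup, with the restricted operations. -/
instance (T : InverseSubsemigroup S) : InverseSemigroup T where
  mul a b := ⟨a.1 * b.1, T.mul_mem' a.2 b.2⟩
  mul_assoc a b c := Subtype.ext (mul_assoc a.1 b.1 c.1)
  inv a := ⟨a.1⁻¹, T.inv_mem' a.2⟩
  mul_inv_mul a := Subtype.ext (InverseSemigroup.mul_inv_mul a.1)
  inv_mul_inv a := Subtype.ext (InverseSemigroup.inv_mul_inv a.1)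
  eq_inv_of_inverse a b h₁ h₂ := Subtype.ext
    (InverseSemigroup.eq_inv_of_inverse a.1 b.1 (congrArg Subtype.val h₁)
      (congrArg Subtype.val h₂))

end InverseSubsemigroup

namespace InverseSemigroup

/-- `S` is finitely generated: it is generated, as an inverse semigroup, by finitely many
(and at least one) elements; in other words, the only inverse subsemigroup containing these
elements is `S`. In particular `S` is non-empty. -/
def FG (S : Type u) [InverseSemigroup S] : Prop :=
  ∃ s : Set S, s.Finite ∧ s.Nonempty ∧
    ∀ T : InverseSubsemigroup S, s ⊆ (T : Set S) → ∀ x : S, x ∈ T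

/-- The maximal subgroup `H_e` of an inverse semigroup at an element `e` (of interest when `e` is
idempotent): the set of all `a` with `a a⁻¹ = e = a⁻¹ a`. -/
def maximalSubgroup {S : Type u} [InverseSemigroup S] (e : S) : InverseSubsemigroup S where
  carrier := {a | a * a⁻¹ = e ∧ a⁻¹ * a = e}
  mul_mem' := by
    rintro a b ⟨ha₁, ha₂⟩ ⟨hb₁, hb₂⟩
    have hae : a * e = a := by rw [← ha₂, ← mul_assoc]; exact mul_inv_mul a
    have heb : e * b = b := by rw [← hb₁]; exact mul_inv_mul b
    have hea : e * a⁻¹ = a⁻¹ := by rw [← ha₂]; exact inv_mul_inv a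
    have hbe : b⁻¹ * e = b⁻¹ := by rw [← hb₁, ← mul_assoc]; exact inv_mul_inv b
    have h₁ : a * b * (b⁻¹ * a⁻¹) = e := by
      rw [mul_assoc, ← mul_assoc b, hb₁, hea, ha₁]
    have h₂ : b⁻¹ * a⁻¹ * (a * b) = e := by
      rw [mul_assoc, ← mul_assoc a⁻¹, ha₂, heb, hb₂]
    have hea' : e * a = a := by rw [← ha₁]; exact mul_inv_mul a
    have hbe' : e * b⁻¹ = b⁻¹ := by rw [← hb₂]; exact inv_mul_inv b
    have h : b⁻¹ * a⁻¹ = (a * b)⁻¹ := by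
      apply eq_inv_of_inverse
      · rw [h₁, ← mul_assoc, hea']
      · rw [h₂, ← mul_assoc, hbe']
    exact ⟨by rw [← h, h₁], by rw [← h, h₂]⟩
  inv_mem' := by
    rintro a ⟨ha₁, ha₂⟩
    have h : a = a⁻¹⁻¹ := eq_inv_of_inverse a⁻¹ a (inv_mul_inv a) (mul_inv_mul a)
    exact ⟨by rw [← h, ha₂], by rw [← h, ha₁]⟩

end InverseSemigroup

/-- A class of inverse semigroups. -/
abbrev InverseSemigroupClass : Type (u + 1) :=
  ∀ (S : Type u) [InverseSemigroup S], Prop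

/-- The age of an inverse semigroup `M` (for instance of a group): the class of all finitely
generated inverse semigroups that can be embedded in `M`. (A homomorphism of semigroups between
inverse semigroups preserves inverses.) -/
def InverseSemigroup.age (M : Type v) [InverseSemigroup M] : InverseSemigroupClass.{u} :=
  fun T _ => InverseSemigroup.FG T ∧ ∃ f : T →ₙ* M, Function.Injective f

namespace InverseSemigroupClass

/-- The class contains only countably many isomorphism types. -/
def IsCountable (K : InverseSemigroupClass.{u}) : Prop :=
  ∃ (T : ℕ → Type u) (_ : ∀ n, InverseSemigroup (T n)),
    ∀ (S : Type u) [InverseSemigroup S], K S → ∃ n, Nonempty (S ≃* T n)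

/-- The class is closed under isomorphism. -/
def IsClosedUnderIso (K : InverseSemigroupClass.{u}) : Prop :=
  ∀ (A B : Type u) [InverseSemigroup A] [InverseSemigroup B], K A → Nonempty (A ≃* B) → K B

/-- The hereditary property. -/
def HP (K : InverseSemigroupClass.{u}) : Prop :=
  ∀ (A : Type u) [InverseSemigroup A], K A →
    ∀ B : InverseSubsemigroup A, InverseSemigroup.FG B → K B

/-- The joint embedding property. -/
def JEP (K : InverseSemigroupClass.{u}) : Prop :=
  ∀ (B₁ B₂ : Type u) [InverseSemigroup B₁] [InverseSemigroup B₂], K B₁ → K B₂ →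
    ∃ (C : Type u) (_ : InverseSemigroup C) (f₁ : B₁ →ₙ* C) (f₂ : B₂ →ₙ* C),
      K C ∧ Function.Injective f₁ ∧ Function.Injective f₂

/-- The (weak) amalgamation property. -/
def AP (K : InverseSemigroupClass.{u}) : Prop :=
  ∀ (A B₁ B₂ : Type u) [InverseSemigroup A] [InverseSemigroup B₁] [InverseSemigroup B₂],
    K A → Nonempty A → K B₁ → K B₂ →
    ∀ (f₁ : A →ₙ* B₁) (f₂ : A →ₙ* B₂), Function.Injective f₁ → Function.Injective f₂ →
      ∃ (D : Type u) (_ : InverseSemigroup D) (g₁ : B₁ →ₙ* D) (g₂ : B₂ →ₙ* D),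
        K D ∧ Function.Injective g₁ ∧ Function.Injective g₂ ∧ g₁.comp f₁ = g₂.comp f₂

/-- A Fraïssé class of inverse semigroups: a non-empty countable class of finitely generated
inverse semigroups that is closed under isomorphism and has the hereditary, the joint embedding
and the amalgamation property. -/
structure IsFraisse (K : InverseSemigroupClass.{u}) : Prop where
  fg : ∀ (S : Type u) [InverseSemigroup S], K S → InverseSemigroup.FG S
  nonempty : ∃ (S : Type u) (_ : InverseSemigroup S), K S
  countable : K.IsCountable
  closedUnderIso : K.IsClosedUnderIso
  hereditary : K.HP
  jointEmbedding : K.JEP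
  amalgamation : K.AP

end InverseSemigroupClass

/-- The class `K[G]` of all finitely generated commutative inverse semigroups whose maximal
subgroups all belong to the age of the group `G`. -/
def commClassOfGroup (G : Type v) [Group G] : InverseSemigroupClass.{u} :=
  fun S _ => InverseSemigroup.FG S ∧ (∀ a b : S, a * b = b * a) ∧
    ∀ e : S, e * e = e →
      InverseSemigroup.age.{u, v} G (InverseSemigroup.maximalSubgroup e)

/-- A homogeneous group: a countable group in which every isomorphism between finitely generated
subgroups extends to an automorphism. -/
def IsHomogeneousGroup (G : Type v) [Group G] : Prop :=
  Countable G ∧ ∀ A B : Subgroup G, A.FG → B.FG → ∀ φ : A ≃* B,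
    ∃ θ : G ≃* G, ∀ a : A, θ (a : G) = (φ a : G)

/-- A group is co-Hopfian if each of its injective endomorphisms is surjective. -/
def IsCoHopfianGroup (G : Type v) [Group G] : Prop :=
  ∀ f : G →* G, Function.Injective f → Function.Surjective f

/-- An abelian group is component-wise non co-Hopfian if each of its non-trivial `p`-components
is non co-Hopfian and its torsion-free rank is `0` or `ℵ₀`. (The rank over `ℤ` is the largest
size of a linearly independent subset, and so it is the torsion-free rank.) -/
def IsComponentwiseNonCoHopfian (G : Type v) [CommGroup G] : Prop :=
  (∀ (p : ℕ) [Fact p.Prime], Nontrivial (CommGroup.primaryComponent G p) →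
    ¬ IsCoHopfianGroup (CommGroup.primaryComponent G p)) ∧
  (Module.rank ℤ (Additive G) = 0 ∨ Module.rank ℤ (Additive G) = Cardinal.aleph0)

/-! ### Homogeneous abelian groups: avoiding finitely generated subgroups. -/

section HomogeneousGroups

variable {G : Type v} [CommGroup G]

/-! Call a homomorphism into `WithZero G` a character. A character of a finitely generated
commutative inverse semigroup is zero, or it is supported on the elements above a least idempotent e
and is determined by a homomorphism from the maximal subgroup at e to G. Embeddings of the finitely
many maximal subgroups into G therefore give finitely many characters that separate points. So K[G]
consists of the finitely generated inverse subsemigroups of finite powers of `WithZero G`, provided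
that the age of G is closed under finite powers (`exists_injective_of_pi`). Countability and
heredity follow at once.

For amalgamation, extend the separating characters of each factor, restricted to A, to the other
factor; all of them together map both factors into one finite power, injectively and compatibly on
A. Extending characters reduces to extending homomorphisms into G along embeddings within its age
(`IsHomogeneousGroup.exists_extension`).

Both facts about G rest on `EmbedsIndependently`: a cyclic group of infinite or prime power order
that embeds in a finite power of G embeds in G so as to avoid any given finitely generated subgroup.
Non-co-Hopfian components supply infinitely many elements of order p, infinite rank supplies new
infinite cyclic subgroups, and homogeneity moves a given embedding onto the new elements. -/

theorem Subgroup.fg_of_commGroup_fg {A : Type*} [CommGroup A] [Group.FG A] (B : Subgroup A) :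
    Group.FG B := by
  rw [GroupFG.iff_add_fg, ← Module.Finite.iff_addGroup_fg]
  have : Module.Finite ℤ (Additive A) :=
    Module.Finite.iff_addGroup_fg.mpr (GroupFG.iff_add_fg.mp inferInstance)
  exact inferInstanceAs (Module.Finite ℤ (AddSubgroup.toIntSubmodule (Subgroup.toAddSubgroup B)))

/-- In a homogeneous group, any two embeddings of a finitely generated group differ by an
automorphism. -/
theorem IsHomogeneousGroup.exists_mulEquiv (hG : IsHomogeneousGroup G) {A : Type*} [Group A]
    [Group.FG A] (f g : A →* G) (hf : Function.Injective f) (hg : Function.Injective g) :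
    ∃ θ : G ≃* G, ∀ a, θ (f a) = g a := by
  obtain ⟨θ, hθ⟩ := hG.2 f.range g.range ((Group.fg_iff_subgroup_fg _).mp inferInstance)
    ((Group.fg_iff_subgroup_fg _).mp inferInstance)
    ((MonoidHom.ofInjective hf).symm.trans (MonoidHom.ofInjective hg))
  refine ⟨θ, fun a => ?_⟩
  have h := hθ (MonoidHom.ofInjective hf a)
  simpa [MonoidHom.ofInjective_apply] using h

/-- Each non-empty fibre of the p-th power map is a coset of its kernel, so finiteness climbs from
one torsion layer to the next. -/
theorem finite_pow_prime_pow_eq_one {p : ℕ} (h : {x : G | x ^ p = 1}.Finite) (m : ℕ) :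
    {x : G | x ^ p ^ m = 1}.Finite := by
  induction m with
  | zero => simp
  | succ m ih =>
    have key : {x : G | x ^ p ^ (m + 1) = 1} = (powMonoidHom p : G →* G) ⁻¹' {x | x ^ p ^ m = 1} := by
      ext x
      simp [pow_succ', pow_mul]
    rw [key]
    refine Set.Finite.preimage' ih fun b _ => ?_
    by_cases hb : ∃ y : G, y ^ p = b
    · obtain ⟨y, rfl⟩ := hb
      refine (h.image (y * ·)).subset fun x hx => ⟨y⁻¹ * x, ?_, by simp⟩
      have hx : x ^ p = y ^ p := hx
      simp [mul_pow, hx]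
    · convert Set.finite_empty
      ext x
      simp only [Set.mem_preimage, Set.mem_singleton_iff, Set.mem_empty_iff_false, iff_false]
      exact fun hx => hb ⟨x, hx⟩

/-- An injective endomorphism maps each layer of p^m-torsion into itself; the layers are finite, so
it is onto on each, and they exhaust the component. -/
theorem isCoHopfianGroup_primaryComponent {p : ℕ} [Fact p.Prime] (h : {x : G | x ^ p = 1}.Finite) :
    IsCoHopfianGroup (CommGroup.primaryComponent G p) := by
  intro f hf y
  obtain ⟨m, hm⟩ : ∃ m : ℕ, (y : G) ^ p ^ m = 1 := y.2
  have hfin : {x : CommGroup.primaryComponent G p | x ^ p ^ m = 1}.Finite := by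
    refine Set.Finite.of_finite_image (f := Subtype.val)
      ((finite_pow_prime_pow_eq_one h m).subset ?_) Subtype.val_injective.injOn
    rintro _ ⟨x, hx, rfl⟩
    have hx : x ^ p ^ m = 1 := hx
    simpa using congrArg Subtype.val hx
  have hmaps : Set.MapsTo f {x | x ^ p ^ m = 1} {x | x ^ p ^ m = 1} := fun x hx => by
    have hx : x ^ p ^ m = 1 := hx
    simp [← map_pow, hx]
  have := hfin.to_subtype
  obtain ⟨x, hx⟩ := (Finite.injective_iff_surjective (f := hmaps.restrict f _ _)).mp
    (fun a b hab => Subtype.ext (hf (congrArg Subtype.val hab))) ⟨y, Subtype.ext (by simpa using hm)⟩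
  exact ⟨x, congrArg Subtype.val hx⟩

/-- Given an element of order `p`, a finitely generated subgroup omits some element of order `p`. -/
theorem IsComponentwiseNonCoHopfian.exists_pow_prime_eq_one_notMem
    (hG : IsComponentwiseNonCoHopfian G) {p : ℕ} (hp : p.Prime) {w : G} (hw : w ^ p = 1)
    (hw1 : w ≠ 1) (K : Subgroup G) [Group.FG K] : ∃ x : G, x ^ p = 1 ∧ x ∉ K := by
  by_contra! hK
  have : Fact p.Prime := ⟨hp⟩
  have hnt : Nontrivial (CommGroup.primaryComponent G p) := by
    refine ⟨⟨w, 1, by simpa using hw⟩, 1, fun h => hw1 (congrArg Subtype.val h)⟩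
  refine hG.1 p hnt (isCoHopfianGroup_primaryComponent ?_)
  -- If K contained all p-torsion of G, that torsion would be a finitely generated torsion abelian
  -- group, hence finite, and the component would be co-Hopfian.
  let T : Subgroup K := (powMonoidHom p : K →* K).ker
  have hT : Group.FG T := Subgroup.fg_of_commGroup_fg T
  have hmem (x : T) : (x : K) ^ p = 1 := x.2
  have : Finite T := CommGroup.finite_of_fg_isMulTorsion T fun x =>
    isOfFinOrder_iff_pow_eq_one.mpr ⟨p, hp.pos, Subtype.ext (by simpa using hmem x)⟩
  refine (Set.finite_range fun x : T => ((x : K) : G)).subset fun x hx => ?_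
  exact ⟨⟨⟨x, hK x hx⟩, Subtype.ext hx⟩, rfl⟩

/-- If the torsion-free rank is `ℵ₀`, every finitely generated subgroup is avoided by some infinite
cyclic subgroup. -/
theorem exists_zpow_mem_imp_eq_zero (hG : Module.rank ℤ (Additive G) = Cardinal.aleph0)
    (K : Subgroup G) [Group.FG K] : ∃ g : G, ∀ m : ℤ, g ^ m ∈ K → m = 0 := by
  let N : Submodule ℤ (Additive G) := AddSubgroup.toIntSubmodule (Subgroup.toAddSubgroup K)
  have hN : Module.Finite ℤ N := by
    have : AddGroup.FG (Additive K) := GroupFG.iff_add_fg.mp inferInstance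
    exact Module.Finite.iff_addGroup_fg.mpr this
  -- K has finite rank, so the quotient by it has non-zero rank; a lift of a non-torsion element of
  -- the quotient does the job.
  have hrank := rank_quotient_add_rank_of_isDomain N
  have hne : Module.rank ℤ (Additive G ⧸ N) ≠ 0 := by
    intro h0
    rw [h0, zero_add, hG] at hrank
    exact (Module.rank_lt_aleph0 ℤ N).ne hrank
  rw [Ne, rank_eq_zero_iff] at hne
  push Not at hne
  obtain ⟨q, hq⟩ := hne
  obtain ⟨g, rfl⟩ := Submodule.Quotient.mk_surjective N q
  refine ⟨g.toMul, fun m hm => ?_⟩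
  by_contra hm0
  refine hq m hm0 ?_
  rw [← Submodule.Quotient.mk_smul, Submodule.Quotient.mk_eq_zero]
  exact hm

/-! ### Independent embeddings of finitely generated abelian groups. -/

/-- `X` can be embedded in `G` so as to meet any given finitely generated subgroup trivially. -/
def EmbedsIndependently (X : Type*) [CommGroup X] (G : Type*) [CommGroup G] : Prop :=
  ∀ (K : Subgroup G) [Group.FG K], ∃ f : X →* G, ∀ x, f x ∈ K → x = 1

theorem EmbedsIndependently.of_subsingleton (X : Type*) [CommGroup X] [Subsingleton X] :
    EmbedsIndependently X G :=
  fun _ _ => ⟨1, fun _ _ => Subsingleton.elim _ _⟩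

theorem EmbedsIndependently.of_injective {X Y : Type*} [CommGroup X] [CommGroup Y]
    (h : EmbedsIndependently Y G) (i : X →* Y) (hi : Function.Injective i) :
    EmbedsIndependently X G := fun K _ => by
  obtain ⟨f, hf⟩ := h K
  exact ⟨f.comp i, fun x hx => hi (by rw [map_one]; exact hf _ hx)⟩

theorem EmbedsIndependently.exists_injective {X : Type*} [CommGroup X]
    (h : EmbedsIndependently X G) : ∃ f : X →* G, Function.Injective f := by
  obtain ⟨f, hf⟩ := h ⊥
  exact ⟨f, (injective_iff_map_eq_one f).mpr fun x hx => hf x (by simp [hx])⟩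

/-- Let X avoid K first, then let Y avoid the join of K with the image of X. -/
theorem EmbedsIndependently.prod {X Y : Type*} [CommGroup X] [CommGroup Y] [Group.FG X]
    (hX : EmbedsIndependently X G) (hY : EmbedsIndependently Y G) :
    EmbedsIndependently (X × Y) G := fun K hK => by
  obtain ⟨f, hf⟩ := hX K
  have : Group.FG (K ⊔ f.range : Subgroup G) := by
    rw [Group.fg_iff_subgroup_fg] at hK ⊢
    exact hK.sup ((Group.fg_iff_subgroup_fg _).mp inferInstance)
  obtain ⟨g, hg⟩ := hY (K ⊔ f.range)
  refine ⟨f.coprod g, fun ⟨x, y⟩ hxy => ?_⟩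
  rw [MonoidHom.coprod_apply] at hxy
  have hy : y = 1 := by
    refine hg y ?_
    have h : g y = (f x * g y) * f x⁻¹ := by simp [mul_comm]
    rw [h]
    exact Subgroup.mul_mem_sup hxy ⟨_, rfl⟩
  subst hy
  rw [map_one, mul_one] at hxy
  rw [hf x hxy, Prod.mk_one_one]

theorem EmbedsIndependently.pi {J : Type*} [Finite J] : ∀ (X : J → Type) [∀ j, CommGroup (X j)]
    [∀ j, Group.FG (X j)], (∀ j, EmbedsIndependently (X j) G) →
    EmbedsIndependently (∀ j, X j) G := by
  refine Finite.induction_empty_option (P := fun J => ∀ (X : J → Type) [∀ j, CommGroup (X j)]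
    [∀ j, Group.FG (X j)], (∀ j, EmbedsIndependently (X j) G) →
    EmbedsIndependently (∀ j, X j) G) ?_ ?_ ?_ J
  · intro J J' e ih X _ _ h
    refine (ih (fun j => X (e j)) fun j => h (e j)).of_injective
      (MonoidHom.pi fun j => Pi.evalMonoidHom X (e j)) fun x y hxy => ?_
    funext j
    obtain ⟨j, rfl⟩ := e.surjective j
    exact congrFun hxy j
  · intro X _ _ _
    exact .of_subsingleton _
  · intro J _ ih X _ _ h
    refine ((h none).prod (ih (fun j => X (some j)) fun j => h (some j))).of_injective
      ((Pi.evalMonoidHom X none).prod (MonoidHom.pi fun j => Pi.evalMonoidHom X (some j)))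
      fun x y hxy => ?_
    funext j
    cases j with
    | none => exact congrArg Prod.fst hxy
    | some j => exact congrFun (congrArg Prod.snd hxy) j

/-- In rank 0 every coordinate of the image of the generator is torsion, and the product of the
finitely many exponents kills the generator, which is absurd. The embedding thus only serves to
force infinite rank. -/
theorem EmbedsIndependently.int {ι : Type*} [Finite ι]
    (hG : IsComponentwiseNonCoHopfian G) (ψ : Multiplicative ℤ →* (ι → G))
    (hψ : Function.Injective ψ) : EmbedsIndependently (Multiplicative ℤ) G := by
  intro K _
  obtain h0 | h := hG.2
  · exfalso
    have _ := Fintype.ofFinite ι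
    rw [rank_eq_zero_iff] at h0
    have hfin (i : ι) : ∃ a : ℤ, a ≠ 0 ∧ ψ (.ofAdd 1) i ^ a = 1 := by
      obtain ⟨a, ha, h⟩ := h0 (.ofMul (ψ (.ofAdd 1) i))
      exact ⟨a, ha, h⟩
    choose a ha h using hfin
    have h1 : ψ (.ofAdd 1) ^ (∏ i, a i) = 1 := by
      funext i
      obtain ⟨c, hc⟩ := Finset.dvd_prod_of_mem a (Finset.mem_univ i)
      rw [Pi.pow_apply, hc, zpow_mul, h, one_zpow, Pi.one_apply]
    rw [← map_zpow, ← map_one ψ] at h1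
    have h2 := congrArg Multiplicative.toAdd (hψ h1)
    simp [Finset.prod_eq_zero_iff, ha] at h2
  · obtain ⟨g, hg⟩ := exists_zpow_mem_imp_eq_zero h K
    refine ⟨zpowersHom G g, fun x hx => ?_⟩
    exact Multiplicative.toAdd.injective (hg x.toAdd (by simpa using hx))

/-- Every non-trivial subgroup of a cyclic p-group contains its subgroup of order p. Hence a
coordinate of `ψ` that is non-trivial there is injective, and it avoids K as soon as an automorphism
of G moves that subgroup off K. -/
theorem EmbedsIndependently.zmod {ι : Type*} (hG : IsHomogeneousGroup G)
    (hG' : IsComponentwiseNonCoHopfian G) {p : ℕ} (hp : p.Prime) (e : ℕ)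
    (ψ : Multiplicative (ZMod (p ^ e)) →* (ι → G)) (hψ : Function.Injective ψ) :
    EmbedsIndependently (Multiplicative (ZMod (p ^ e))) G := by
  intro K _
  obtain _ | k := e
  · have : Subsingleton (ZMod (p ^ 0)) := by rw [pow_zero]; infer_instance
    exact EmbedsIndependently.of_subsingleton _ K
  let c : Multiplicative (ZMod (p ^ (k + 1))) := .ofAdd 1
  have hc (m : ℤ) : c ^ m = 1 ↔ (p : ℤ) ^ (k + 1) ∣ m := by
    rw [← Nat.cast_pow, ← ZMod.intCast_zmod_eq_zero_iff_dvd, ← toAdd_eq_zero, toAdd_zpow]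
    simp [c]
  have hgen (x : Multiplicative (ZMod (p ^ (k + 1)))) : ∃ m : ℤ, c ^ m = x := by
    obtain ⟨m, hm⟩ := ZMod.intCast_surjective x.toAdd
    exact ⟨m, Multiplicative.toAdd.injective (by simp [c, hm])⟩
  have hp1 : (p : ℤ) ≠ 0 := by exact_mod_cast hp.ne_zero
  have hne : ψ (c ^ ((p : ℤ) ^ k)) ≠ 1 := by
    rw [← map_one ψ, hψ.ne_iff, Ne, hc, pow_succ]
    intro h
    have := (mul_dvd_mul_iff_left (pow_ne_zero k hp1)).mp (h.trans (mul_one _).symm.dvd)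
    exact hp.one_lt.ne' (by exact_mod_cast Int.eq_one_of_dvd_one (by positivity) this)
  obtain ⟨i, hi⟩ := Function.ne_iff.mp hne
  let f : Multiplicative (ZMod (p ^ (k + 1))) →* G := (Pi.evalMonoidHom _ i).comp ψ
  have hfp : f (c ^ ((p : ℤ) ^ k)) ^ p = 1 := by
    rw [← map_pow, ← zpow_natCast, ← zpow_mul, ← pow_succ, (hc _).mpr dvd_rfl, map_one]
  obtain ⟨x, hxp, hxK⟩ := hG'.exists_pow_prime_eq_one_notMem hp hfp hi K
  have hx1 : x ≠ 1 := fun h => hxK (h ▸ K.one_mem)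
  have : Fact p.Prime := ⟨hp⟩
  obtain ⟨θ, hθ⟩ : ∃ θ : G ≃* G, θ (f (c ^ ((p : ℤ) ^ k))) = x := by
    have h := (orderOf_eq_prime hfp hi).trans (orderOf_eq_prime hxp hx1).symm
    let e := mulEquivOfOrderOfEq
      (g := (⟨f (c ^ ((p : ℤ) ^ k)), Subgroup.mem_zpowers _⟩ : Subgroup.zpowers _))
      (g' := (⟨x, Subgroup.mem_zpowers _⟩ : Subgroup.zpowers x))
      (fun y => by obtain ⟨_, m, rfl⟩ := y; exact ⟨m, rfl⟩)
      (fun y => by obtain ⟨_, m, rfl⟩ := y; exact ⟨m, rfl⟩)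
      (by rw [← Subgroup.orderOf_coe, ← Subgroup.orderOf_coe]; exact h)
    obtain ⟨θ, hθ⟩ := hG.2 _ _ ⟨{f (c ^ ((p : ℤ) ^ k))}, by simp [Subgroup.zpowers_eq_closure]⟩
      ⟨{x}, by simp [Subgroup.zpowers_eq_closure]⟩ e
    refine ⟨θ, (hθ ⟨_, Subgroup.mem_zpowers _⟩).trans ?_⟩
    exact congrArg Subtype.val (mulEquivOfOrderOfEq_apply_gen ..)
  refine ⟨θ.toMonoidHom.comp f, fun y hy => ?_⟩
  obtain ⟨m, rfl⟩ := hgen y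
  rw [hc]
  -- The gcd of m and p^(k+1) is some p^j. If j = k+1 then c^m = 1; otherwise Bézout exhibits
  -- c^(p^k) as a power of c^m, which would put x in K.
  obtain ⟨j, hj, hd⟩ := (Nat.dvd_prime_pow hp).mp
    (Int.gcd_dvd_natAbs_right m ((p ^ (k + 1) : ℕ) : ℤ))
  obtain rfl | hjk := hj.eq_or_lt
  · have := Int.gcd_dvd_left m ((p ^ (k + 1) : ℕ) : ℤ)
    rw [hd] at this
    exact_mod_cast this
  refine absurd ?_ hxK
  have hgcd := Int.gcd_eq_gcd_ab m ((p ^ (k + 1) : ℕ) : ℤ)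
  have hpow : c ^ ((p : ℤ) ^ k) =
      (c ^ m) ^ (Int.gcdA m ((p ^ (k + 1) : ℕ) : ℤ) * (p : ℤ) ^ (k - j)) := by
    rw [← zpow_mul, ← mul_inv_eq_one, ← zpow_neg, ← zpow_add, hc]
    refine ⟨Int.gcdB m ((p ^ (k + 1) : ℕ) : ℤ) * (p : ℤ) ^ (k - j), ?_⟩
    have hk : (p : ℤ) ^ k = (p : ℤ) ^ j * (p : ℤ) ^ (k - j) := by
      rw [← pow_add, Nat.add_sub_cancel' (Nat.lt_succ_iff.mp hjk)]
    rw [hd] at hgcd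
    push_cast at hgcd ⊢
    rw [hk, hgcd]
    ring
  rw [← hθ, hpow, map_zpow, map_zpow]
  exact K.zpow_mem hy _

/-- The age of `G` is closed under finite powers. -/
theorem IsHomogeneousGroup.exists_injective_of_pi (hG : IsHomogeneousGroup G)
    (hG' : IsComponentwiseNonCoHopfian G) {H ι : Type*} [CommGroup H] [Group.FG H] [Finite ι]
    (ψ : H →* (ι → G)) (hψ : Function.Injective ψ) : ∃ f : H →* G, Function.Injective f := by
  classical
  obtain ⟨I, J, _, _, p, hp, e, ⟨E⟩⟩ := CommGroup.equiv_free_prod_prod_multiplicative_zmod H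
  have (i : I) : NeZero (p i ^ e i) := ⟨pow_ne_zero _ (hp i).ne_zero⟩
  have (i : I) : Finite (Multiplicative (ZMod (p i ^ e i))) :=
    inferInstanceAs (Finite (ZMod (p i ^ e i)))
  have hψE : Function.Injective (ψ.comp E.symm.toMonoidHom) := hψ.comp E.symm.injective
  have h₁ : EmbedsIndependently (J → Multiplicative ℤ) G := by
    refine .pi _ fun j => .int hG' ((ψ.comp E.symm.toMonoidHom).comp
      ((MonoidHom.inl _ _).comp (MonoidHom.mulSingle (fun _ => Multiplicative ℤ) j))) ?_
    exact hψE.comp ((Prod.mk_left_injective 1).comp (Pi.mulSingle_injective (M := fun _ => Multiplicative ℤ) j))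
  have h₂ : EmbedsIndependently (∀ i, Multiplicative (ZMod (p i ^ e i))) G := by
    refine .pi _ fun i => .zmod hG hG' (hp i) (e i) ((ψ.comp E.symm.toMonoidHom).comp
      ((MonoidHom.inr _ _).comp
        (MonoidHom.mulSingle (fun i => Multiplicative (ZMod (p i ^ e i))) i))) ?_
    exact hψE.comp ((Prod.mk_right_injective 1).comp (Pi.mulSingle_injective (M := fun i => Multiplicative (ZMod (p i ^ e i))) i))
  exact ((h₁.prod h₂).of_injective E.toMonoidHom E.injective).exists_injective

/-- Homomorphisms into `G` extend along embeddings into members of the age of `G`. -/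
theorem IsHomogeneousGroup.exists_extension (hG : IsHomogeneousGroup G)
    (hG' : IsComponentwiseNonCoHopfian G) {A H : Type*} [CommGroup A] [CommGroup H] [Group.FG A]
    [Group.FG H] (i : H →* G) (hi : Function.Injective i) (f : A →* H)
    (hf : Function.Injective f) (χ : A →* G) : ∃ χ' : H →* G, ∀ a, χ' (f a) = χ a := by
  have : Group.FG (H × χ.range) := by
    rw [Group.fg_iff_monoid_fg]
    infer_instance
  obtain ⟨j, hj⟩ : ∃ j : H × χ.range →* G, Function.Injective j := by
    refine hG.exists_injective_of_pi hG' (MonoidHom.pi fun b : Bool =>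
      if b then i.comp (MonoidHom.fst _ _) else χ.range.subtype.comp (MonoidHom.snd _ _)) ?_
    intro x y hxy
    exact Prod.ext (hi (congrFun hxy true)) (Subtype.ext (congrFun hxy false))
  -- A has two embeddings in G, a ↦ j(f a, 1) and a ↦ j(f a, χ a); `θ` carries the first to the
  -- second, and `τ` below undoes `j` on the second factor.
  obtain ⟨θ, hθ⟩ := hG.exists_mulEquiv (j.comp ((MonoidHom.inl _ _).comp f))
    (j.comp (f.prod χ.rangeRestrict)) (hj.comp ((Prod.mk_left_injective 1).comp hf))
    (hj.comp fun a b hab => hf (congrArg Prod.fst hab))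
  obtain ⟨τ, hτ⟩ := hG.exists_mulEquiv (j.comp (MonoidHom.inr _ _)) χ.range.subtype
    (hj.comp (Prod.mk_right_injective 1)) (Subgroup.subtype_injective _)
  let k : H →* G := j.comp (MonoidHom.inl _ _)
  -- The quotient of `θ ∘ k` by `k` is defined on all of H, and at f a it isolates j(1, χ a).
  refine ⟨τ.toMonoidHom.comp ((θ.toMonoidHom.comp k) / k), fun a => ?_⟩
  refine Eq.trans ?_ (hτ (χ.rangeRestrict a))
  have h₁ : θ (k (f a)) = j (f a, χ.rangeRestrict a) := hθ a
  have h₂ : (f a, χ.rangeRestrict a) = (f a, 1) * (1, χ.rangeRestrict a) := by simp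
  change τ (θ (k (f a)) / k (f a)) = τ (j (1, χ.rangeRestrict a))
  rw [h₁, h₂, map_mul]
  exact congrArg τ (mul_div_cancel_left _ _)

end HomogeneousGroups

/-! ### Inverse semigroups, their homomorphisms and generated subsemigroups. -/

namespace InverseSemigroup

section Basic

variable {S : Type u} [InverseSemigroup S] {T : Type v} [InverseSemigroup T]

theorem map_inv (f : S →ₙ* T) (a : S) : f a⁻¹ = (f a)⁻¹ := by
  apply eq_inv_of_inverse
  · rw [← map_mul, ← map_mul, mul_inv_mul]
  · rw [← map_mul, ← map_mul, inv_mul_inv]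

theorem inv_eq_self_of_idem {e : S} (he : e * e = e) : e⁻¹ = e :=
  (eq_inv_of_inverse e e (by rw [he, he]) (by rw [he, he])).symm

theorem mul_inv_idem (a : S) : a * a⁻¹ * (a * a⁻¹) = a * a⁻¹ := by
  rw [← mul_assoc, mul_inv_mul]

theorem inverse_inverse (a : S) : a⁻¹⁻¹ = a :=
  (eq_inv_of_inverse a⁻¹ a (inv_mul_inv a) (mul_inv_mul a)).symm

theorem mem_maximalSubgroup {e a : S} : a ∈ maximalSubgroup e ↔ a * a⁻¹ = e ∧ a⁻¹ * a = e :=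
  Iff.rfl

theorem idem_mem_maximalSubgroup {e : S} (he : e * e = e) : e ∈ maximalSubgroup e := by
  rw [mem_maximalSubgroup, inv_eq_self_of_idem he]
  exact ⟨he, he⟩

theorem idem_mul_of_mem {e a : S} (ha : a ∈ maximalSubgroup e) : e * a = a := by
  rw [← ha.1, mul_inv_mul]

end Basic

end InverseSemigroup

namespace InverseSubsemigroup

open InverseSemigroup

variable {S : Type u} [InverseSemigroup S] {T : Type v} [InverseSemigroup T]

/-- The inverse subsemigroup generated by a set. -/
def closure (s : Set S) : InverseSubsemigroup S where
  carrier := {x | ∀ U : InverseSubsemigroup S, s ⊆ (U : Set S) → x ∈ U}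
  mul_mem' ha hb U hU := U.mul_mem' (ha U hU) (hb U hU)
  inv_mem' ha U hU := U.inv_mem' (ha U hU)

theorem subset_closure (s : Set S) : s ⊆ (closure s : Set S) := fun _ hx _ hU => hU hx

theorem fg_closure {s : Set S} (hs : s.Finite) (hne : s.Nonempty) : FG (closure s) := by
  refine ⟨Subtype.val ⁻¹' s, hs.preimage Subtype.val_injective.injOn, ?_, fun U hU x => ?_⟩
  · obtain ⟨a, ha⟩ := hne
    exact ⟨⟨a, subset_closure s ha⟩, ha⟩
  · let V : InverseSubsemigroup S :=
      { carrier := {a | ∃ h : a ∈ closure s, (⟨a, h⟩ : closure s) ∈ U}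
        mul_mem' := fun ⟨h₁, h₁'⟩ ⟨h₂, h₂'⟩ => ⟨(closure s).mul_mem' h₁ h₂, U.mul_mem' h₁' h₂'⟩
        inv_mem' := fun ⟨h, h'⟩ => ⟨(closure s).inv_mem' h, U.inv_mem' h'⟩ }
    obtain ⟨_, h⟩ := x.2 V fun a ha => ⟨subset_closure s ha, hU ha⟩
    exact h

/-- The preimage of an inverse subsemigroup. -/
def comap (f : S →ₙ* T) (U : InverseSubsemigroup T) : InverseSubsemigroup S where
  carrier := {a | f a ∈ U}
  mul_mem' {a b} ha hb := by
    change f (a * b) ∈ U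
    rw [map_mul]
    exact U.mul_mem' ha hb
  inv_mem' {a} ha := by
    change f a⁻¹ ∈ U
    rw [InverseSemigroup.map_inv]
    exact U.inv_mem' ha

/-- The range of a homomorphism. -/
def range (f : S →ₙ* T) : InverseSubsemigroup T where
  carrier := Set.range f
  mul_mem' := by
    rintro _ _ ⟨a, rfl⟩ ⟨b, rfl⟩
    exact ⟨a * b, map_mul f a b⟩
  inv_mem' := by
    rintro _ ⟨a, rfl⟩
    exact ⟨a⁻¹, InverseSemigroup.map_inv f a⟩

/-- The inclusion homomorphism. -/
def subtype (U : InverseSubsemigroup S) : U →ₙ* S where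
  toFun := Subtype.val
  map_mul' _ _ := rfl

/-- Restriction of the codomain of a homomorphism. -/
def codRestrict (f : S →ₙ* T) (U : InverseSubsemigroup T) (h : ∀ a, f a ∈ U) : S →ₙ* U where
  toFun a := ⟨f a, h a⟩
  map_mul' a b := Subtype.ext (map_mul f a b)

end InverseSubsemigroup

/-! ### Commutative inverse semigroups: idempotents and maximal subgroups. -/

namespace InverseSemigroup

open InverseSubsemigroup

section Commutative

variable {S : Type u} [InverseSemigroup S]

theorem mul_inv_of_comm (hS : ∀ a b : S, a * b = b * a) (a b : S) : (a * b)⁻¹ = a⁻¹ * b⁻¹ := by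
  have : Std.Commutative (α := S) (· * ·) := ⟨hS⟩
  refine (eq_inv_of_inverse _ _ ?_ ?_).symm
  · calc a * b * (a⁻¹ * b⁻¹) * (a * b) = (a * a⁻¹ * a) * (b * b⁻¹ * b) := by ac_rfl
      _ = a * b := by rw [mul_inv_mul, mul_inv_mul]
  · calc a⁻¹ * b⁻¹ * (a * b) * (a⁻¹ * b⁻¹) = (a⁻¹ * a * a⁻¹) * (b⁻¹ * b * b⁻¹) := by ac_rfl
      _ = a⁻¹ * b⁻¹ := by rw [inv_mul_inv, inv_mul_inv]

theorem mul_mul_inv_of_comm (hS : ∀ a b : S, a * b = b * a) (a b : S) :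
    a * b * (a * b)⁻¹ = (a * a⁻¹) * (b * b⁻¹) := by
  have : Std.Commutative (α := S) (· * ·) := ⟨hS⟩
  rw [mul_inv_of_comm hS]
  ac_rfl

theorem mem_maximalSubgroup_of_comm (hS : ∀ a b : S, a * b = b * a) {e a : S} :
    a ∈ maximalSubgroup e ↔ a * a⁻¹ = e := by
  rw [mem_maximalSubgroup, hS a⁻¹ a, and_self]

theorem mul_idem_mem_maximalSubgroup (hS : ∀ a b : S, a * b = b * a) {e a : S} (he : e * e = e)
    (ha : a * a⁻¹ * e = e) : a * e ∈ maximalSubgroup e := by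
  rw [mem_maximalSubgroup_of_comm hS, mul_mul_inv_of_comm hS, inv_eq_self_of_idem he, he, ha]

/-- The condition a a⁻¹ e = e says that a lies above e. The elements that do not lie above e are
absorbed by products, which lets characters vanish on them. -/
theorem mul_mul_inv_mul_eq_iff (hS : ∀ a b : S, a * b = b * a) {a b e : S} :
    a * b * (a * b)⁻¹ * e = e ↔ a * a⁻¹ * e = e ∧ b * b⁻¹ * e = e := by
  have : Std.Commutative (α := S) (· * ·) := ⟨hS⟩
  rw [mul_mul_inv_of_comm hS]
  constructor
  · intro h
    constructor
    · rw [← h]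
      calc a * a⁻¹ * (a * a⁻¹ * (b * b⁻¹) * e)
          = a * a⁻¹ * (a * a⁻¹) * (b * b⁻¹) * e := by ac_rfl
        _ = _ := by rw [mul_inv_idem]
    · rw [← h]
      calc b * b⁻¹ * (a * a⁻¹ * (b * b⁻¹) * e)
          = a * a⁻¹ * (b * b⁻¹ * (b * b⁻¹)) * e := by ac_rfl
        _ = _ := by rw [mul_inv_idem]
  · rintro ⟨h₁, h₂⟩
    rw [mul_assoc, h₂, h₁]

theorem inv_mul_inv_inv_mul_eq_iff (hS : ∀ a b : S, a * b = b * a) {a e : S} :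
    a⁻¹ * a⁻¹⁻¹ * e = e ↔ a * a⁻¹ * e = e := by
  rw [inverse_inverse, hS a⁻¹ a]

/-- The set of idempotents of a finitely generated commutative inverse semigroup is finite. -/
theorem finite_idem_of_fg (hS : ∀ a b : S, a * b = b * a) (h : FG S) :
    {e : S | e * e = e}.Finite := by
  classical
  obtain ⟨s, hs, -, hgen⟩ := h
  let _ : CommSemigroup S := { mul_comm := hS }
  -- Idempotents will be products of the a a⁻¹ over subsets of the generators; adjoining an identity
  -- gives the empty product a value.
  let P : Set (WithOne S) := (fun t : Finset S => ∏ a ∈ t, ((a * a⁻¹ : S) : WithOne S)) ''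
    (hs.toFinset.powerset : Set (Finset S))
  have hidem (a : S) : ((a * a⁻¹ : S) : WithOne S) * ((a * a⁻¹ : S) : WithOne S) =
      ((a * a⁻¹ : S) : WithOne S) := by
    rw [← WithOne.coe_mul, mul_inv_idem]
  let U : InverseSubsemigroup S :=
    { carrier := {x | ((x * x⁻¹ : S) : WithOne S) ∈ P}
      mul_mem' := by
        rintro a b ⟨t₁, h₁, h₁'⟩ ⟨t₂, h₂, h₂'⟩
        simp only [Finset.coe_powerset, Set.mem_preimage, Set.mem_powerset_iff,
          Finset.coe_subset] at h₁ h₂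
        refine ⟨t₁ ∪ t₂, Finset.mem_coe.mpr (Finset.mem_powerset.mpr (Finset.union_subset h₁ h₂)),
          ?_⟩
        dsimp only at h₁' h₂' ⊢
        -- The two products together count the intersection twice; idempotence absorbs the
        -- repetition.
        have h := Finset.prod_sdiff (f := fun a => ((a * a⁻¹ : S) : WithOne S))
          (Finset.inter_subset_union (s := t₁) (t := t₂))
        rw [mul_mul_inv_of_comm hS, WithOne.coe_mul, ← h₁', ← h₂', ← Finset.prod_union_inter,
          ← h, mul_assoc, ← Finset.prod_mul_distrib]
        simp only [hidem]
      inv_mem' := by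
        intro a ha
        change ((a⁻¹ * a⁻¹⁻¹ : S) : WithOne S) ∈ P
        rw [inverse_inverse, hS]
        exact ha }
  have hU := hgen U fun a ha => ⟨{a}, by simpa using ha, by simp⟩
  have hP : P.Finite := (Finset.finite_toSet _).image _
  refine (hP.preimage (f := ((↑) : S → WithOne S)) WithOne.coe_injective.injOn).subset fun e he => ?_
  have h1 : ((e * e⁻¹ : S) : WithOne S) ∈ P := hU e
  have he : e * e = e := he
  rwa [inv_eq_self_of_idem he, he] at h1

/-- Maximal subgroups of finitely generated commutative inverse semigroups are finitely
generated. -/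
theorem fg_maximalSubgroup (hS : ∀ a b : S, a * b = b * a) (h : FG S) {e : S} (he : e * e = e) :
    FG (maximalSubgroup e) := by
  obtain ⟨s, hs, -, hgen⟩ := h
  refine ⟨insert ⟨e, idem_mem_maximalSubgroup he⟩ (Subtype.val ⁻¹' ((· * e) '' s)),
    ((hs.image _).preimage Subtype.val_injective.injOn).insert _, Set.insert_nonempty _ _,
    fun M hM x => ?_⟩
  have : Std.Commutative (α := S) (· * ·) := ⟨hS⟩
  -- Multiplication by e carries the elements above e into the maximal subgroup; the others satisfy
  -- the condition vacuously. So the products s e that lie in the subgroup, s a generator, generate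
  -- it together with e.
  let U : InverseSubsemigroup S :=
    { carrier := {a | ∀ h : a * a⁻¹ * e = e,
        (⟨a * e, mul_idem_mem_maximalSubgroup hS he h⟩ : maximalSubgroup e) ∈ M}
      mul_mem' := by
        intro a b ha hb h
        obtain ⟨h₁, h₂⟩ := (mul_mul_inv_mul_eq_iff hS).mp h
        have heq : (⟨a * b * e, mul_idem_mem_maximalSubgroup hS he h⟩ : maximalSubgroup e) =
            ⟨a * e, mul_idem_mem_maximalSubgroup hS he h₁⟩ *
              ⟨b * e, mul_idem_mem_maximalSubgroup hS he h₂⟩ := Subtype.ext <| by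
          calc a * b * e = a * b * (e * e) := by rw [he]
            _ = (a * e) * (b * e) := by ac_rfl
        rw [heq]
        exact M.mul_mem' (ha h₁) (hb h₂)
      inv_mem' := by
        intro a ha h
        have h₁ := (inv_mul_inv_inv_mul_eq_iff hS).mp h
        have heq : (⟨a⁻¹ * e, mul_idem_mem_maximalSubgroup hS he h⟩ : maximalSubgroup e) =
            (⟨a * e, mul_idem_mem_maximalSubgroup hS he h₁⟩)⁻¹ := Subtype.ext <| by
          change a⁻¹ * e = (a * e)⁻¹
          rw [mul_inv_of_comm hS, inv_eq_self_of_idem he]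
        rw [heq]
        exact M.inv_mem' (ha h₁) }
  have hx : (x : S) * e = x := by rw [hS, idem_mul_of_mem x.2]
  have hx' : (x : S) * (x : S)⁻¹ * e = e := by rw [x.2.1, he]
  have hxU : (x : S) ∈ U := hgen U (fun a ha _ => hM (Set.mem_insert_of_mem _ ⟨a, ha, rfl⟩)) x
  have h := hxU hx'
  convert h using 1
  exact Subtype.ext hx.symm

/-- The maximal subgroup at an idempotent of a commutative inverse semigroup is a group. -/
abbrev maximalSubgroupCommGroup (hS : ∀ a b : S, a * b = b * a) {e : S} (he : e * e = e) :
    CommGroup (maximalSubgroup e) where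
  one := ⟨e, idem_mem_maximalSubgroup he⟩
  one_mul a := Subtype.ext (idem_mul_of_mem a.2)
  mul_one a := Subtype.ext ((hS _ _).trans (idem_mul_of_mem a.2))
  inv_mul_cancel a := Subtype.ext a.2.2
  mul_comm a b := Subtype.ext (hS _ _)

theorem group_fg_maximalSubgroup (hS : ∀ a b : S, a * b = b * a) {e : S} (he : e * e = e)
    (h : FG (maximalSubgroup e)) :
    letI := maximalSubgroupCommGroup hS he
    Group.FG (maximalSubgroup e) := by
  let _ := maximalSubgroupCommGroup hS he
  obtain ⟨s, hs, -, hgen⟩ := h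
  refine Group.fg_iff.mpr ⟨s, (Subgroup.eq_top_iff' _).mpr fun x => ?_, hs⟩
  exact hgen
    { carrier := Subgroup.closure s
      mul_mem' := (Subgroup.closure s).mul_mem
      inv_mem' := (Subgroup.closure s).inv_mem } Subgroup.subset_closure x

end Commutative

end InverseSemigroup

/-! ### Characters with values in a group with zero. -/

namespace InverseSemigroup

open InverseSubsemigroup

/-- Finite powers of a commutative group with zero are (commutative) inverse semigroups. -/
noncomputable instance piWithZero (ι : Type*) (G : Type*) [CommGroup G] :
    InverseSemigroup (ι → WithZero G) where
  mul_inv_mul a := funext fun i => mul_inv_mul_cancel (a i)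
  inv_mul_inv a := funext fun i => by
    have := mul_inv_mul_cancel (a i)⁻¹
    rwa [inv_inv] at this
  eq_inv_of_inverse a b h₁ h₂ := funext fun i => by
    have h₁ : a i * b i * a i = a i := congrFun h₁ i
    have h₂ : b i * a i * b i = b i := congrFun h₂ i
    change b i = (a i)⁻¹
    by_cases ha : a i = 0
    · rw [← h₂, ha, mul_zero, zero_mul, inv_zero]
    · exact eq_inv_of_mul_eq_one_right ((mul_eq_right₀ ha).mp h₁)

section Characters

variable {S : Type u} [InverseSemigroup S] {G : Type v} [CommGroup G]

open Classical in
/-- The character that a homomorphism on a maximal subgroup induces. -/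
noncomputable def inducedCharacter (hS : ∀ a b : S, a * b = b * a) {e : S} (he : e * e = e)
    (χ : maximalSubgroup e →ₙ* G) : S →ₙ* WithZero G where
  toFun a := if h : a * a⁻¹ * e = e then
    (χ ⟨a * e, mul_idem_mem_maximalSubgroup hS he h⟩ : G) else 0
  map_mul' a b := by
    by_cases ha : a * a⁻¹ * e = e
    · by_cases hb : b * b⁻¹ * e = e
      · rw [dif_pos ha, dif_pos hb, dif_pos ((mul_mul_inv_mul_eq_iff hS).mpr ⟨ha, hb⟩),
          ← WithZero.coe_mul, ← map_mul]
        congr 2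
        refine Subtype.ext ?_
        have : Std.Commutative (α := S) (· * ·) := ⟨hS⟩
        calc a * b * e = a * b * (e * e) := by rw [he]
          _ = (a * e) * (b * e) := by ac_rfl
      · rw [dif_neg hb, mul_zero, dif_neg fun h => hb ((mul_mul_inv_mul_eq_iff hS).mp h).2]
    · rw [dif_neg ha, zero_mul, dif_neg fun h => ha ((mul_mul_inv_mul_eq_iff hS).mp h).1]

theorem inducedCharacter_of_le (hS : ∀ a b : S, a * b = b * a) {e : S} (he : e * e = e)
    (χ : maximalSubgroup e →ₙ* G) {a : S} (h : a * a⁻¹ * e = e) :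
    inducedCharacter hS he χ a = (χ ⟨a * e, mul_idem_mem_maximalSubgroup hS he h⟩ : G) :=
  dif_pos h

theorem inducedCharacter_of_not_le (hS : ∀ a b : S, a * b = b * a) {e : S} (he : e * e = e)
    (χ : maximalSubgroup e →ₙ* G) {a : S} (h : ¬ a * a⁻¹ * e = e) :
    inducedCharacter hS he χ a = 0 :=
  dif_neg h

theorem inducedCharacter_ne_zero_iff (hS : ∀ a b : S, a * b = b * a) {e : S} (he : e * e = e)
    (χ : maximalSubgroup e →ₙ* G) {a : S} :
    inducedCharacter hS he χ a ≠ 0 ↔ a * a⁻¹ * e = e := by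
  by_cases h : a * a⁻¹ * e = e
  · simp [inducedCharacter_of_le hS he χ h, h]
  · simp [inducedCharacter_of_not_le hS he χ h, h]

/-- Characters induced from embeddings of the maximal subgroups separate points. -/
theorem eq_of_inducedCharacter_eq (hS : ∀ a b : S, a * b = b * a)
    (χ : ∀ e : {e : S // e * e = e}, maximalSubgroup e.1 →ₙ* G)
    (hχ : ∀ e, Function.Injective (χ e)) {a b : S}
    (h : ∀ e, inducedCharacter hS e.2 (χ e) a = inducedCharacter hS e.2 (χ e) b) : a = b := by
  have haux (c : S) : c * c⁻¹ * (c * c⁻¹) = c * c⁻¹ := mul_inv_idem c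
  -- Comparing supports at a a⁻¹ and b b⁻¹ shows that these idempotents agree; injectivity on that
  -- one maximal subgroup then finishes.
  have h₁ : b * b⁻¹ * (a * a⁻¹) = a * a⁻¹ := by
    rw [← inducedCharacter_ne_zero_iff hS (haux a) (χ ⟨_, haux a⟩), ← h ⟨_, haux a⟩,
      inducedCharacter_ne_zero_iff]
    exact haux a
  have h₂ : a * a⁻¹ * (b * b⁻¹) = b * b⁻¹ := by
    rw [← inducedCharacter_ne_zero_iff hS (haux b) (χ ⟨_, haux b⟩), h ⟨_, haux b⟩,
      inducedCharacter_ne_zero_iff]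
    exact haux b
  have heq : a * a⁻¹ = b * b⁻¹ := by rw [← h₁, ← h₂, hS, h₂, h₂]
  have h₃ := h ⟨_, haux a⟩
  rw [inducedCharacter_of_le hS _ _ (haux a), inducedCharacter_of_le hS _ _ h₁,
    WithZero.coe_inj] at h₃
  have h₄ : a * (a * a⁻¹) = b * (a * a⁻¹) := congrArg Subtype.val (hχ _ h₃)
  rwa [hS, mul_inv_mul, heq, hS, mul_inv_mul] at h₄

theorem map_inv_ne_zero (χ : S →ₙ* WithZero G) {a : S} (ha : χ a ≠ 0) : χ a⁻¹ ≠ 0 := fun h => by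
  rw [← mul_inv_mul a, map_mul, map_mul, h, mul_zero, zero_mul] at ha
  exact ha rfl

/-- The support of a nonzero character is determined by its least idempotent. -/
theorem exists_idem_support (hS : ∀ a b : S, a * b = b * a) (hfin : {e : S | e * e = e}.Finite)
    (χ : S →ₙ* WithZero G) {a₀ : S} (ha₀ : χ a₀ ≠ 0) :
    ∃ e : S, e * e = e ∧ χ e = 1 ∧ ∀ a, χ a ≠ 0 ↔ a * a⁻¹ * e = e := by
  have : Std.Commutative (α := S) (· * ·) := ⟨hS⟩
  have hne (a : S) (ha : χ a ≠ 0) : χ (a * a⁻¹) ≠ 0 := by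
    rw [map_mul]
    exact mul_ne_zero ha (map_inv_ne_zero χ ha)
  obtain ⟨e, he, heχ, hmin⟩ : ∃ e : S, e * e = e ∧ χ e ≠ 0 ∧
      ∀ f ∈ {e : S | e * e = e}, χ f ≠ 0 → f * e = e := by
    -- The least idempotent is the product of the finitely many idempotents on which the character
    -- is non-zero.
    refine Set.Finite.induction_on (motive := fun F _ => ∃ e : S, e * e = e ∧ χ e ≠ 0 ∧
      ∀ f ∈ F, f * f = f → χ f ≠ 0 → f * e = e) _ hfin ?_ ?_ |>.imp
        fun e ⟨h₁, h₂, h₃⟩ => ⟨h₁, h₂, fun f hf => h₃ f hf hf⟩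
    · exact ⟨a₀ * a₀⁻¹, mul_inv_idem a₀, hne a₀ ha₀, by simp⟩
    · rintro f F - - ⟨e, he, heχ, hmin⟩
      by_cases hf : f * f = f ∧ χ f ≠ 0
      · refine ⟨f * e, ?_, by rw [map_mul]; exact mul_ne_zero hf.2 heχ, ?_⟩
        · calc f * e * (f * e) = (f * f) * (e * e) := by ac_rfl
            _ = f * e := by rw [hf.1, he]
        · rintro g (rfl | hg) hg₁ hg₂
          · rw [← mul_assoc, hg₁]
          · rw [hS f, ← mul_assoc, hmin g hg hg₁ hg₂]
      · refine ⟨e, he, heχ, ?_⟩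
        rintro g (rfl | hg) hg₁ hg₂
        · exact absurd ⟨hg₁, hg₂⟩ hf
        · exact hmin g hg hg₁ hg₂
  refine ⟨e, he, ?_, fun a => ⟨fun ha => hmin _ (mul_inv_idem a) (hne a ha), fun h ha => ?_⟩⟩
  · have h := congrArg χ he
    rw [map_mul] at h
    exact (mul_eq_left₀ heχ).mp h
  · rw [← h, map_mul, map_mul, ha, zero_mul, zero_mul] at heχ
    exact heχ rfl

end Characters

end InverseSemigroup

/-! ### The class inside finite powers of `WithZero G`, and amalgamation. -/

/-- Finitely generated commutative groups embeddable in a finite power of `G` embed in `G`. -/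
def AgeClosedUnderPowers (G : Type u) [CommGroup G] : Prop :=
  ∀ (H : Type u) [CommGroup H] [Group.FG H] (ι : Type u) [Finite ι] (ψ : H →* (ι → G)),
    Function.Injective ψ → ∃ f : H →* G, Function.Injective f

/-- Homomorphisms into `G` extend along embeddings into members of the age of `G`. -/
def InjectiveOverAge (G : Type u) [CommGroup G] : Prop :=
  ∀ (A H : Type u) [CommGroup A] [CommGroup H] [Group.FG A] [Group.FG H] (i : H →* G),
    Function.Injective i → ∀ f : A →* H, Function.Injective f → ∀ χ : A →* G,
      ∃ χ' : H →* G, ∀ a, χ' (f a) = χ a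

namespace commClassOfGroup

open InverseSemigroup InverseSubsemigroup

variable {G : Type u} [CommGroup G]

/-- The members of the class are, up to isomorphism, the finitely generated inverse subsemigroups
of the finite powers of `WithZero G`. -/
theorem of_injective (hG : AgeClosedUnderPowers G) {S : Type u} [InverseSemigroup S] (hS : FG S)
    {ι : Type u} [Finite ι] (h : S →ₙ* (ι → WithZero G)) (hh : Function.Injective h) :
    commClassOfGroup.{u, u} G S := by
  have hcomm (a b : S) : a * b = b * a := hh (by rw [map_mul, map_mul, mul_comm])
  refine ⟨hS, hcomm, fun e he => ?_⟩
  have hfg := fg_maximalSubgroup hcomm hS he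
  refine ⟨hfg, ?_⟩
  let _ := maximalSubgroupCommGroup hcomm he
  have _ := group_fg_maximalSubgroup hcomm he hfg
  have hne (x : maximalSubgroup e) (i : {i // h e i ≠ 0}) : h x i ≠ 0 := fun h0 => by
    have h1 : h ((x : S) * (x : S)⁻¹) i = 0 := by rw [map_mul, Pi.mul_apply, h0, zero_mul]
    rw [x.2.1] at h1
    exact i.2 h1
  -- A coordinate that vanishes at e vanishes on the whole maximal subgroup; every other coordinate
  -- takes values in G there, so the subgroup embeds in a finite power of G.
  obtain ⟨f, hf⟩ := hG (maximalSubgroup e) {i // h e i ≠ 0}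
    (MonoidHom.mk' (fun x i => WithZero.unzero (hne x i)) fun x y => funext fun i => by
      rw [← WithZero.coe_inj]
      change ((WithZero.unzero _ : G) : WithZero G) =
        ((WithZero.unzero (hne x i) * WithZero.unzero (hne y i) : G) : WithZero G)
      rw [WithZero.coe_mul, WithZero.coe_unzero, WithZero.coe_unzero, WithZero.coe_unzero]
      exact congrFun (map_mul h x.1 y.1) i) fun x y hxy => by
    refine Subtype.ext (hh (funext fun i => ?_))
    by_cases hi : h e i = 0
    · rw [← idem_mul_of_mem x.2, ← idem_mul_of_mem y.2, map_mul, map_mul, Pi.mul_apply,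
        Pi.mul_apply, hi, zero_mul, zero_mul]
    · have := congrFun hxy ⟨i, hi⟩
      exact (WithZero.coe_unzero (hne x ⟨i, hi⟩)).symm.trans
        ((WithZero.coe_inj.mpr this).trans (WithZero.coe_unzero (hne y ⟨i, hi⟩)))
  exact ⟨⟨f, f.map_mul⟩, hf⟩

theorem exists_characters {S : Type u} [InverseSemigroup S] (hS : commClassOfGroup.{u, u} G S) :
    ∃ (ι : Type u) (_ : Finite ι) (c : ι → S →ₙ* WithZero G),
      ∀ a b : S, (∀ i, c i a = c i b) → a = b := by
  have hfin := finite_idem_of_fg hS.2.1 hS.1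
  choose f hf using fun e : {e : S // e * e = e} => (hS.2.2 e.1 e.2).2
  exact ⟨{e : S // e * e = e}, hfin.to_subtype, fun e => inducedCharacter hS.2.1 e.2 (f e),
    fun a b h => eq_of_inducedCharacter_eq hS.2.1 f hf h⟩

/-- Characters extend along embeddings into members of the class. -/
theorem exists_extension (hG : InjectiveOverAge G) {A B : Type u} [InverseSemigroup A]
    [InverseSemigroup B] (hA : FG A) (hB : commClassOfGroup.{u, u} G B) (f : A →ₙ* B)
    (hf : Function.Injective f) (χ : A →ₙ* WithZero G) :
    ∃ χ' : B →ₙ* WithZero G, ∀ a, χ' (f a) = χ a := by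
  by_cases h0 : ∀ a, χ a = 0
  · exact ⟨⟨fun _ => 0, fun _ _ => (mul_zero 0).symm⟩, fun a => (h0 a).symm⟩
  push Not at h0
  obtain ⟨a₀, ha₀⟩ := h0
  have hAc (a b : A) : a * b = b * a := hf (by rw [map_mul, map_mul, hB.2.1])
  obtain ⟨e, he, hχe, hsupp⟩ := exists_idem_support hAc (finite_idem_of_fg hAc hA) χ ha₀
  have hfe : f e * f e = f e := by rw [← map_mul, he]
  let _ := maximalSubgroupCommGroup hAc he
  let _ := maximalSubgroupCommGroup hB.2.1 hfe
  have _ := group_fg_maximalSubgroup hAc he (fg_maximalSubgroup hAc hA he)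
  have _ := group_fg_maximalSubgroup hB.2.1 hfe (hB.2.2 _ hfe).1
  obtain ⟨i, hi⟩ := (hB.2.2 _ hfe).2
  have hne (x : maximalSubgroup e) : χ x ≠ 0 := by
    rw [hsupp, x.2.1, he]
  have hmem (x : maximalSubgroup e) : f x ∈ maximalSubgroup (f e) := by
    rw [mem_maximalSubgroup_of_comm hB.2.1, ← InverseSemigroup.map_inv, ← map_mul, x.2.1]
  -- With e the least idempotent of the support, extend the restriction of `χ` from the maximal
  -- subgroup at e to the one at f e, then induce. The supports match because f, being injective,
  -- reflects lying above e.
  obtain ⟨ψ, hψ⟩ := hG (maximalSubgroup e) (maximalSubgroup (f e)) (MonoidHom.mk' i (map_mul i)) hi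
    (MonoidHom.mk' (fun x => ⟨f x, hmem x⟩) fun x y => Subtype.ext (map_mul f x.1 y.1))
    (fun x y hxy => Subtype.ext (hf (congrArg Subtype.val hxy)))
    (MonoidHom.mk' (fun x => WithZero.unzero (hne x)) fun x y => by
      rw [← WithZero.coe_inj, WithZero.coe_mul, WithZero.coe_unzero, WithZero.coe_unzero,
        WithZero.coe_unzero]
      exact map_mul χ x.1 y.1)
  refine ⟨inducedCharacter hB.2.1 hfe ⟨ψ, ψ.map_mul⟩, fun a => ?_⟩
  have hiff : f a * (f a)⁻¹ * f e = f e ↔ a * a⁻¹ * e = e := by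
    rw [← InverseSemigroup.map_inv, ← map_mul, ← map_mul, hf.eq_iff]
  by_cases ha : a * a⁻¹ * e = e
  · rw [inducedCharacter_of_le hB.2.1 hfe _ (hiff.mpr ha)]
    have hx := mul_idem_mem_maximalSubgroup hAc he ha
    have h := WithZero.coe_inj.mpr (hψ ⟨a * e, hx⟩)
    have h' : ((WithZero.unzero (hne ⟨a * e, hx⟩) : G) : WithZero G) = χ a := by
      rw [WithZero.coe_unzero, map_mul, hχe, mul_one]
    refine Eq.trans ?_ (h.trans h')
    refine congrArg (fun y => ((ψ y : G) : WithZero G)) (Subtype.ext (map_mul f a e).symm)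
  · rw [inducedCharacter_of_not_le hB.2.1 hfe _ (mt hiff.mp ha)]
    by_contra h
    exact ha ((hsupp a).mp (Ne.symm h))

/-- Embeddings of `A` (which may be empty) into two members of the class can be amalgamated. -/
theorem exists_amalgam (hG : AgeClosedUnderPowers G) (hG' : InjectiveOverAge G)
    {A B₁ B₂ : Type u} [InverseSemigroup A] [InverseSemigroup B₁] [InverseSemigroup B₂]
    (hA : IsEmpty A ∨ FG A)
    (h₁ : commClassOfGroup.{u, u} G B₁) (h₂ : commClassOfGroup.{u, u} G B₂)
    (f₁ : A →ₙ* B₁) (f₂ : A →ₙ* B₂) (hf₁ : Function.Injective f₁) (hf₂ : Function.Injective f₂) :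
    ∃ (D : Type u) (_ : InverseSemigroup D) (g₁ : B₁ →ₙ* D) (g₂ : B₂ →ₙ* D),
      commClassOfGroup.{u, u} G D ∧ Function.Injective g₁ ∧ Function.Injective g₂ ∧
        g₁.comp f₁ = g₂.comp f₂ := by
  have hext {B : Type u} [InverseSemigroup B] (hB : commClassOfGroup.{u, u} G B) (f : A →ₙ* B)
      (hf : Function.Injective f) (χ : A →ₙ* WithZero G) :
      ∃ χ' : B →ₙ* WithZero G, ∀ a, χ' (f a) = χ a := by
    obtain hA | hA := hA
    · exact ⟨⟨fun _ => 0, fun _ _ => (mul_zero 0).symm⟩, fun a => hA.elim a⟩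
    · exact exists_extension hG' hA hB f hf χ
  obtain ⟨ι₁, _, c₁, hc₁⟩ := exists_characters h₁
  obtain ⟨ι₂, _, c₂, hc₂⟩ := exists_characters h₂
  choose d₁ hd₁ using fun i => hext h₂ f₂ hf₂ ((c₁ i).comp f₁)
  choose d₂ hd₂ using fun i => hext h₁ f₁ hf₁ ((c₂ i).comp f₂)
  -- On each factor its own characters give injectivity, and the extended ones give agreement on A.
  let k₁ : B₁ →ₙ* (ι₁ ⊕ ι₂ → WithZero G) :=
    { toFun := fun x => Sum.elim (c₁ · x) (d₂ · x)
      map_mul' := fun x y => by funext i; cases i <;> simp }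
  let k₂ : B₂ →ₙ* (ι₁ ⊕ ι₂ → WithZero G) :=
    { toFun := fun x => Sum.elim (d₁ · x) (c₂ · x)
      map_mul' := fun x y => by funext i; cases i <;> simp }
  obtain ⟨s₁, hs₁, hne₁, hgen₁⟩ := h₁.1
  obtain ⟨s₂, hs₂, -, hgen₂⟩ := h₂.1
  let D : InverseSubsemigroup (ι₁ ⊕ ι₂ → WithZero G) := closure (k₁ '' s₁ ∪ k₂ '' s₂)
  have hk₁ : ∀ x, k₁ x ∈ D :=
    hgen₁ (comap k₁ D) fun x hx => subset_closure _ (Or.inl ⟨x, hx, rfl⟩)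
  have hk₂ : ∀ x, k₂ x ∈ D :=
    hgen₂ (comap k₂ D) fun x hx => subset_closure _ (Or.inr ⟨x, hx, rfl⟩)
  refine ⟨D, inferInstance, codRestrict k₁ D hk₁, codRestrict k₂ D hk₂, ?_, ?_, ?_, ?_⟩
  · exact of_injective hG (fg_closure ((hs₁.image _).union (hs₂.image _)) (hne₁.image _).inl)
      (subtype D) Subtype.val_injective
  · intro x y hxy
    exact hc₁ x y fun i => congrFun (congrArg Subtype.val hxy) (Sum.inl i)
  · intro x y hxy
    exact hc₂ x y fun i => congrFun (congrArg Subtype.val hxy) (Sum.inr i)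
  · ext a : 1
    refine Subtype.ext (funext fun i => ?_)
    cases i with
    | inl i => exact (hd₁ i a).symm
    | inr i => exact hd₂ i a

theorem exists_embedding_pi_fin {S : Type u} [InverseSemigroup S]
    (hS : commClassOfGroup.{u, u} G S) :
    ∃ (n : ℕ) (h : S →ₙ* (Fin n → WithZero G)), Function.Injective h := by
  obtain ⟨ι, _, c, hc⟩ := exists_characters hS
  obtain ⟨n, ⟨E⟩⟩ := Finite.exists_equiv_fin ι
  refine ⟨n, { toFun := fun x i => c (E.symm i) x, map_mul' := fun x y => ?_ }, fun x y hxy => ?_⟩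
  · funext i
    exact map_mul _ _ _
  · refine hc x y fun i => ?_
    have := congrFun hxy (E i)
    simpa using this

/-- A generating set is mapped by an embedding onto a generating set of an isomorphic copy. -/
theorem nonempty_mulEquiv_closure {S T : Type*} [InverseSemigroup S] [InverseSemigroup T] {s : Set S}
    (hs : ∀ U : InverseSubsemigroup S, s ⊆ (U : Set S) → ∀ x : S, x ∈ U) (h : S →ₙ* T)
    (hh : Function.Injective h) : Nonempty (S ≃* closure (h '' s)) := by
  have hmem : ∀ x, h x ∈ closure (h '' s) :=
    hs (comap h (closure (h '' s))) fun x hx => subset_closure _ ⟨x, hx, rfl⟩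
  refine ⟨MulEquiv.ofBijective (codRestrict h _ hmem)
    ⟨fun x y hxy => hh (congrArg Subtype.val hxy), fun y => ?_⟩⟩
  obtain ⟨x, hx⟩ := y.2 (InverseSubsemigroup.range h) (by rintro _ ⟨x, -, rfl⟩; exact ⟨x, rfl⟩)
  exact ⟨x, Subtype.ext hx⟩

theorem isFraisse [Countable G] (hG : AgeClosedUnderPowers G) (hG' : InjectiveOverAge G) :
    InverseSemigroupClass.IsFraisse (commClassOfGroup.{u, u} G) where
  fg S _ hS := hS.1
  nonempty := by
    refine ⟨PUnit, inferInstance, of_injective hG (ι := PEmpty)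
      ⟨Set.univ, Set.finite_univ, Set.univ_nonempty, fun T hT x => hT (Set.mem_univ x)⟩
      { toFun := fun _ => 1, map_mul' := fun _ _ => Subsingleton.elim _ _ }
      fun _ _ _ => rfl⟩
  countable := by
    have _ : Countable (WithZero G) := inferInstanceAs (Countable (Option G))
    -- Each member is generated by a finite subset of some power indexed by `Fin n`, and there are
    -- countably many such pairs.
    obtain ⟨t, ht⟩ := exists_surjective_nat (Σ n : ℕ, Finset (Fin n → WithZero G))
    refine ⟨fun k => closure ((t k).2 : Set (Fin (t k).1 → WithZero G)), fun k => inferInstance,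
      fun S _ hS => ?_⟩
    obtain ⟨n, h, hh⟩ := exists_embedding_pi_fin hS
    obtain ⟨s, hs, -, hgen⟩ := hS.1
    obtain ⟨k, hk⟩ := ht ⟨n, (hs.image h).toFinset⟩
    have key : ∀ x : Σ n : ℕ, Finset (Fin n → WithZero G), x = ⟨n, (hs.image h).toFinset⟩ →
        Nonempty (S ≃* closure (x.2 : Set (Fin x.1 → WithZero G))) := by
      rintro _ rfl
      rw [Set.Finite.coe_toFinset]
      exact nonempty_mulEquiv_closure hgen h hh
    exact ⟨k, key _ hk⟩
  closedUnderIso A B _ _ hA := by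
    rintro ⟨E⟩
    obtain ⟨ι, _, c, hc⟩ := exists_characters hA
    have hFG : FG B := by
      obtain ⟨s, hs, hne, hgen⟩ := hA.1
      refine ⟨E '' s, hs.image _, hne.image _, fun T hT x => ?_⟩
      have h := hgen (comap (E : A →ₙ* B) T) (fun a ha => hT ⟨a, ha, rfl⟩) (E.symm x)
      have h : E (E.symm x) ∈ T := h
      rwa [E.apply_symm_apply] at h
    refine of_injective hG hFG (ι := ι)
      { toFun := fun x i => c i (E.symm x), map_mul' := fun x y => ?_ } fun x y hxy => ?_
    · funext i
      simp
    · exact E.symm.injective (hc _ _ fun i => congrFun hxy i)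
  hereditary A _ hA B hB := by
    obtain ⟨ι, _, c, hc⟩ := exists_characters hA
    refine of_injective hG hB (ι := ι)
      { toFun := fun x i => c i x, map_mul' := fun x y => ?_ } fun x y hxy => ?_
    · funext i
      exact map_mul (c i) x.1 y.1
    · exact Subtype.ext (hc _ _ fun i => congrFun hxy i)
  jointEmbedding B₁ B₂ _ _ h₁ h₂ := by
    -- Joint embedding is amalgamation over the empty semigroup, where characters extend by zero.
    let _ : InverseSemigroup PEmpty.{u + 1} :=
      { toSemigroup := inferInstance
        inv := id
        mul_inv_mul := fun a => a.elim
        inv_mul_inv := fun a => a.elim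
        eq_inv_of_inverse := fun a => a.elim }
    obtain ⟨D, _, g₁, g₂, hD, hg₁, hg₂, -⟩ := exists_amalgam hG hG' (A := PEmpty)
      (Or.inl inferInstance) h₁ h₂ ⟨PEmpty.elim, fun a => a.elim⟩ ⟨PEmpty.elim, fun a => a.elim⟩
      (fun a => a.elim) (fun a => a.elim)
    exact ⟨D, _, g₁, g₂, hD, hg₁, hg₂⟩
  amalgamation A B₁ B₂ _ _ _ hA _ h₁ h₂ f₁ f₂ hf₁ hf₂ :=
    exists_amalgam hG hG' (Or.inr hA.1) h₁ h₂ f₁ f₂ hf₁ hf₂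

theorem eq_of_mulEquiv {G : Type*} {G' : Type*} [Group G] [Group G'] (E : G ≃* G') :
    commClassOfGroup.{u} G = commClassOfGroup.{u} G' := by
  funext S _
  refine propext (and_congr_right fun _ => and_congr_right fun _ => forall_congr' fun e =>
    imp_congr_right fun _ => and_congr_right fun _ => ?_)
  exact ⟨fun ⟨f, hf⟩ => ⟨(E : G →ₙ* G').comp f, E.injective.comp hf⟩,
    fun ⟨f, hf⟩ => ⟨(E.symm : G' →ₙ* G).comp f, E.symm.injective.comp hf⟩⟩

end commClassOfGroup

/-! ### Transport to another universe and conclusion. -/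

theorem IsHomogeneousGroup.ageClosedUnderPowers {G : Type v} [CommGroup G]
    (hG : IsHomogeneousGroup G) (hG' : IsComponentwiseNonCoHopfian G) {G' : Type u} [CommGroup G']
    (E : G ≃* G') : AgeClosedUnderPowers G' := by
  intro H _ _ ι _ ψ hψ
  obtain ⟨f, hf⟩ := hG.exists_injective_of_pi hG'
    (MonoidHom.pi fun i => E.symm.toMonoidHom.comp ((Pi.evalMonoidHom _ i).comp ψ))
    fun x y hxy => hψ (funext fun i => E.symm.injective (congrFun hxy i))
  exact ⟨E.toMonoidHom.comp f, E.injective.comp hf⟩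

theorem IsHomogeneousGroup.injectiveOverAge {G : Type v} [CommGroup G]
    (hG : IsHomogeneousGroup G) (hG' : IsComponentwiseNonCoHopfian G) {G' : Type u} [CommGroup G']
    (E : G ≃* G') : InjectiveOverAge G' := by
  intro A H _ _ _ _ i hi f hf χ
  obtain ⟨χ', h⟩ := hG.exists_extension hG' (E.symm.toMonoidHom.comp i)
    (E.symm.injective.comp hi) f hf (E.symm.toMonoidHom.comp χ)
  refine ⟨E.toMonoidHom.comp χ', fun a => ?_⟩
  change E (χ' (f a)) = χ a
  rw [h]
  exact E.apply_symm_apply _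

theorem proposition5 (G : Type v) [CommGroup G] (hG : IsHomogeneousGroup G)
    (hG' : IsComponentwiseNonCoHopfian G) :
    InverseSemigroupClass.IsFraisse (commClassOfGroup.{u, v} G) := by
  have _ : Countable G := hG.1
  -- Being countable, G has a copy in the universe of the semigroups, so that powers of `WithZero G`
  -- live there too.
  let E : G ≃* Shrink.{u} G := (Shrink.mulEquiv.{u, v} (α := G)).symm
  have _ : Countable (Shrink.{u} G) := E.symm.injective.countable
  have h := commClassOfGroup.isFraisse (hG.ageClosedUnderPowers hG' E) (hG.injectiveOverAge hG' E)
  rwa [← commClassOfGroup.eq_of_mulEquiv E] at h
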